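/- Let $\mathbf f = 01001010\cdots$ be the infinite Fibonacci word, i.e., the (unique) infinite word over $\{0,1\}$ that is a fixed point of the morphism $0 \mapsto 01$, $1 \mapsto 0$. An integer $p \ge 1$ is a period of a finite word $w = w[1]\cdots w[n]$ if $p \le n$ and $w[i] = w[i+p]$ for $1 \le i \le n-p$. A nonempty finite word $w$ is a repetition if it has a period $p \le |w|/2$. A repetition factorization of a finite word $w$ is a nonempty list $w_1, \ldots, w_t$ of repetitions such that $w = w_1 w_2 \cdots w_t$; its width is $t$. (a) Every finite factor (contiguous block) of $\mathbf f$ that has a repetition factorization has one of width at most $3$. (b) Every finite prefix of $\mathbf f$ that has a repetition factorization has one of width at most $2$. -/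

import Mathlib

namespace FibRep

/-- The length-`n` block `f[i..i+n-1]` of an infinite word `f`. -/
def block {α : Type*} (f : ℕ → α) (i n : ℕ) : List α :=
  (List.range n).map fun k => f (i + k)

/-- `w` is a (finite) factor of the infinite word `f`. -/
def IsFactor {α : Type*} (w : List α) (f : ℕ → α) : Prop :=
  ∃ i n : ℕ, w = block f i n

/-- `w` is a (finite) prefix of the infinite word `f`. -/
def IsPrefix {α : Type*} (w : List α) (f : ℕ → α) : Prop :=
  ∃ n : ℕ, w = block f 0 n

/-- `p` is a period of the finite word `w`: `1 ≤ p ≤ |w|` and `w[i] = w[i + p]` whenever both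
letters exist (the content of `List.HasPeriod`, see `List.hasPeriod_iff_getElem?`). -/
def IsPeriod {α : Type*} (w : List α) (p : ℕ) : Prop :=
  1 ≤ p ∧ p ≤ w.length ∧ w.HasPeriod p

/-- A nonempty word is a repetition if it has a period at most half its length. -/
def IsRepetition {α : Type*} (w : List α) : Prop :=
  w ≠ [] ∧ ∃ p : ℕ, IsPeriod w p ∧ 2 * p ≤ w.length

/-- `ws` is a repetition factorization of `w`. -/
def IsRepFactorization {α : Type*} (w : List α) (ws : List (List α)) : Prop :=
  ws ≠ [] ∧ ws.flatten = w ∧ ∀ u ∈ ws, IsRepetition u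

/-- `w` has a repetition factorization. -/
def HasRepFactorization {α : Type*} (w : List α) : Prop :=
  ∃ ws : List (List α), IsRepFactorization w ws

/-- The width of a factorization: its number of terms. -/
def width {α : Type*} (ws : List (List α)) : ℕ := ws.length

/-- The morphism `0 ↦ 01`, `1 ↦ 0` on letters. -/
def fibLetter (a : Fin 2) : List (Fin 2) := if a = 0 then [0, 1] else [0]

/-- The morphism `0 ↦ 01`, `1 ↦ 0` on finite words. -/
def fibMorphism (w : List (Fin 2)) : List (Fin 2) := w.flatMap fibLetter

/-- The iterate `φ^n(0)` of the morphism. -/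
def fibIterate (n : ℕ) : List (Fin 2) := fibMorphism^[n] [0]

theorem fibMorphism_append (u v : List (Fin 2)) :
    fibMorphism (u ++ v) = fibMorphism u ++ fibMorphism v := by
  simp [fibMorphism]

theorem fibIterate_succ (n : ℕ) : fibIterate (n + 1) = fibMorphism (fibIterate n) := by
  simp only [fibIterate, Function.iterate_succ_apply']

theorem fibIterate_add_two (n : ℕ) :
    fibIterate (n + 2) = fibIterate (n + 1) ++ fibIterate n := by
  induction n with
  | zero => decide
  | succ n ih => rw [fibIterate_succ (n + 2), ih, fibMorphism_append, ← fibIterate_succ, ← fibIterate_succ, ih]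

theorem lt_length_fibIterate (n : ℕ) : n < (fibIterate n).length := by
  induction n using Nat.twoStepInduction with
  | zero => decide
  | one => decide
  | more n h1 h2 => rw [fibIterate_add_two, List.length_append]; omega

/-- The infinite Fibonacci word: the limit of the words `φ^n(0)`, each of which is a prefix of
the next.  Letter `n` is read off from `φ^n(0)`, which has more than `n` letters. -/
def fibWord (n : ℕ) : Fin 2 := (fibIterate n)[n]'(lt_length_fibIterate n)

/-- The infinite word `f` is a fixed point of the morphism: the image of each of its
prefixes is again a prefix. -/
def IsFibFixedPoint (f : ℕ → Fin 2) : Prop :=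
  ∀ n : ℕ, IsPrefix (fibMorphism (block f 0 n)) f

theorem fibIterate_prefix_succ (n : ℕ) : fibIterate n <+: fibIterate (n + 1) := by
  cases n with
  | zero => decide
  | succ n => rw [fibIterate_add_two]; exact List.prefix_append _ _

theorem fibIterate_prefix {m n : ℕ} (h : m ≤ n) : fibIterate m <+: fibIterate n := by
  induction n, h using Nat.le_induction with
  | base => exact List.prefix_refl _
  | succ n _ ih => exact ih.trans (fibIterate_prefix_succ n)

theorem getElem_fibIterate {m k : ℕ} (h : k < (fibIterate m).length) :
    (fibIterate m)[k] = fibWord k := by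
  rcases le_total m k with hk | hk
  · exact (fibIterate_prefix hk).getElem h
  · exact ((fibIterate_prefix hk).getElem (lt_length_fibIterate k)).symm

theorem isPrefix_of_prefix_fibIterate {w : List (Fin 2)} {m : ℕ} (h : w <+: fibIterate m) :
    IsPrefix w fibWord := by
  refine ⟨w.length, List.ext_getElem (by simp [block]) fun k h1 _ => ?_⟩
  rw [h.getElem h1, getElem_fibIterate]
  simp [block]

theorem block_prefix_fibIterate (n : ℕ) : block fibWord 0 n <+: fibIterate n := by
  have h : block fibWord 0 n = (fibIterate n).take n := by
    have := lt_length_fibIterate n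
    refine List.ext_getElem (by simp [block]; omega) fun k _ _ => ?_
    rw [List.getElem_take, getElem_fibIterate]
    simp [block]
  rw [h]
  exact List.take_prefix _ _

/-- The Fibonacci word is a fixed point of the morphism `0 ↦ 01`, `1 ↦ 0`. -/
theorem isFibFixedPoint_fibWord : IsFibFixedPoint fibWord := by
  intro n
  obtain ⟨t, ht⟩ := block_prefix_fibIterate n
  refine isPrefix_of_prefix_fibIterate (m := n + 1) ⟨fibMorphism t, ?_⟩
  rw [← fibMorphism_append, ht, fibIterate_succ]

/-- It is the only fixed point. -/
theorem IsFibFixedPoint.eq_fibWord {f : ℕ → Fin 2} (hf : IsFibFixedPoint f) : f = fibWord := by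
  have key : ∀ n, fibIterate n = block f 0 (fibIterate n).length := by
    intro n
    induction n with
    | zero =>
      obtain ⟨l, hl⟩ := hf 1
      have h0 : (fibMorphism (block f 0 1))[0]? = some 0 := by
        simp only [block, fibMorphism, fibLetter, List.range_one, List.map_cons, List.map_nil,
          List.flatMap_cons, List.flatMap_nil]
        split_ifs <;> rfl
      rw [hl] at h0
      rcases l with _ | l
      · simp [block] at h0
      · simp [block] at h0
        simp [fibIterate, block, h0]
    | succ n ih =>
      obtain ⟨l, hl⟩ := hf (fibIterate n).length
      rw [← ih, ← fibIterate_succ] at hl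
      have hlen : (fibIterate (n + 1)).length = l := by rw [hl]; simp [block]
      rw [hlen]; exact hl
  funext k
  have h := lt_length_fibIterate k
  have h2 : (fibIterate k)[k]? = (block f 0 (fibIterate k).length)[k]? := by rw [← key k]
  rw [List.getElem?_eq_getElem h, getElem_fibIterate h] at h2
  simp [block, h] at h2
  exact h2.symm

end FibRep

/-!
The proof desubstitutes. Write `φ` for the morphism. If `u` is a repetition with period `p`, then
`φ u ++ [0]` has the period `|φ (u.take p)|`, because every nonempty image begins with `0`, and it
is longer than twice that period (`RepetitionWithSlack.fibMorphism_append_zero`). Hence a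
factorization of `v` is carried to one of the same width of `φ v`, of `φ v ++ [0]`, and of
`fibConj v`, which is `φ v ++ [0]` without its first letter.

Every factor other than `[]` and `[1]` arises from a factor `v` in one of these three
ways, or is `φ v` without its first letter, where `v` begins and ends with `0`
(`desubstitution`). The fourth way is the only one that can destroy a factorization: the first term
of the factorization loses its first letter (or, using `fibConj`, the last term loses its last
letter), which is harmless when this term is longer than twice its period. So the property carried
through the induction is `Robust`: width at most 3 and, for a word that begins and ends with `0`,
a factorization with such slack in its first or its last term. A word that begins and ends with `0`
is of the form `φ v ++ [0]`, and there the slack comes for free, so `Robust` passes from `v` to all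
its descendants (`Robust.of_mem_descendants`).

It remains to treat the factors without a robust ancestor. There are finitely many of them, since
every path in the tree of descendants of `[]` and `[1]` soon reaches a robust word, and on each of
them it is checked that a concatenation of four repetitions is one of at most three (`tame_nil`,
`tame_one`). This holds then for all factors, and as factors are closed under prefixes it allows any
factorization to be shortened to width 3 (`hasWidthLE_flatten`). Prefixes of the Fibonacci word are
only of the forms `φ v` and `φ v ++ [0]` with a prefix `v`, so for them no slack is needed and the
same argument gives width 2.
-/

namespace FibRep

/-! ### Repetitions with slack and bounded width -/

section Words

variable {α : Type*}

/-- `w` has a period `p ≥ 1` with `2 * p + c ≤ |w|`: a repetition with `c` letters to spare. -/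
def RepetitionWithSlack (c : ℕ) (w : List α) : Prop :=
  ∃ p, 1 ≤ p ∧ 2 * p + c ≤ w.length ∧ w.HasPeriod p

theorem hasPeriod_iff_drop_prefix {w : List α} {p : ℕ} : w.HasPeriod p ↔ w.drop p <+: w := by
  refine ⟨fun h => h.drop_prefix, fun h => ?_⟩
  have h' := (List.prefix_append_right_inj (w.take p)).2 h
  rwa [List.take_append_drop] at h'

theorem repetitionWithSlack_iff_mem_range {c : ℕ} {w : List α} :
    RepetitionWithSlack c w ↔
      ∃ p ∈ List.range (w.length / 2 + 1), 1 ≤ p ∧ 2 * p + c ≤ w.length ∧ w.drop p <+: w := by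
  simp only [RepetitionWithSlack, hasPeriod_iff_drop_prefix, List.mem_range]
  refine ⟨fun ⟨p, h1, h2, h3⟩ => ⟨p, by omega, h1, h2, h3⟩, fun ⟨p, _, h⟩ => ⟨p, h⟩⟩

instance [DecidableEq α] (c : ℕ) (w : List α) : Decidable (RepetitionWithSlack c w) :=
  decidable_of_iff' _ repetitionWithSlack_iff_mem_range

theorem repetitionWithSlack_zero_iff {w : List α} : RepetitionWithSlack 0 w ↔ IsRepetition w := by
  constructor
  · rintro ⟨p, h1, h2, h3⟩
    refine ⟨?_, p, ⟨h1, by omega, h3⟩, by omega⟩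
    rintro rfl
    simp at h2
    omega
  · rintro ⟨_, p, ⟨h1, _, h3⟩, h2⟩
    exact ⟨p, h1, by omega, h3⟩

/-- Passing to a factor that is shorter by at most `d` letters costs at most `d` of the slack. -/
theorem RepetitionWithSlack.of_infix {c d : ℕ} {v w : List α} (h : RepetitionWithSlack (c + d) w)
    (hv : v <:+: w) (hl : w.length ≤ v.length + d) : RepetitionWithSlack c v := by
  obtain ⟨p, h1, h2, h3⟩ := h
  exact ⟨p, h1, by omega, h3.infix hv⟩

theorem RepetitionWithSlack.mono {c d : ℕ} {w : List α} (h : RepetitionWithSlack d w)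
    (hcd : c ≤ d) : RepetitionWithSlack c w := by
  obtain ⟨p, h1, h2, h3⟩ := h
  exact ⟨p, h1, by omega, h3⟩

/-- `w` is a concatenation of at most `k` repetitions (of none, if `w = []`). The recursive form
makes the property decidable. -/
def HasWidthLE : ℕ → List α → Prop
  | 0, w => w = []
  | k + 1, w => w = [] ∨ ∃ i ∈ List.range (w.length + 1),
      RepetitionWithSlack 0 (w.take i) ∧ HasWidthLE k (w.drop i)

instance HasWidthLE.decidable [DecidableEq α] : ∀ (k : ℕ) (w : List α), Decidable (HasWidthLE k w)
  | 0, w => inferInstanceAs (Decidable (w = []))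
  | k + 1, w =>
    have (v : List α) : Decidable (HasWidthLE k v) := HasWidthLE.decidable k v
    inferInstanceAs (Decidable (w = [] ∨ ∃ i ∈ List.range (w.length + 1),
      RepetitionWithSlack 0 (w.take i) ∧ HasWidthLE k (w.drop i)))

theorem hasWidthLE_nil (k : ℕ) : HasWidthLE k ([] : List α) := by
  cases k
  · rfl
  · exact Or.inl rfl

theorem HasWidthLE.cons {k : ℕ} {u v : List α} (hu : RepetitionWithSlack 0 u)
    (hv : HasWidthLE k v) : HasWidthLE (k + 1) (u ++ v) :=
  Or.inr ⟨u.length, by simp, by simpa using hu, by simpa using hv⟩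

theorem hasWidthLE_iff {k : ℕ} {w : List α} :
    HasWidthLE k w ↔
      ∃ ws : List (List α), ws.length ≤ k ∧ ws.flatten = w ∧ ∀ u ∈ ws, IsRepetition u := by
  constructor
  · induction k generalizing w with
    | zero => rintro rfl; exact ⟨[], by simp⟩
    | succ k ih =>
      rintro (rfl | ⟨i, _, h1, h2⟩)
      · exact ⟨[], by simp⟩
      · obtain ⟨ws, hl, hf, hr⟩ := ih h2
        refine ⟨w.take i :: ws, by simpa using hl, by simp [hf], ?_⟩
        simpa using ⟨repetitionWithSlack_zero_iff.1 h1, hr⟩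
  · rintro ⟨ws, hl, rfl, hr⟩
    induction ws generalizing k with
    | nil => exact hasWidthLE_nil k
    | cons u ws ih =>
      obtain _ | k := k
      · simp at hl
      · rw [List.flatten_cons]
        exact HasWidthLE.cons (repetitionWithSlack_zero_iff.2 (hr u (by simp)))
          (ih (by simpa using hl) fun v hv => hr v (by simp [hv]))

theorem HasWidthLE.append_singleton {k : ℕ} {u v : List α} (hu : HasWidthLE k u)
    (hv : IsRepetition v) : HasWidthLE (k + 1) (u ++ v) := by
  obtain ⟨ws, hl, hf, hr⟩ := hasWidthLE_iff.1 hu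
  refine hasWidthLE_iff.2 ⟨ws ++ [v], by simpa using hl, by simp [hf], fun x hx => ?_⟩
  rcases List.mem_append.1 hx with hx | hx
  · exact hr x hx
  · rwa [List.mem_singleton.1 hx]

/-- A map that respects concatenation and preserves repetitions preserves the width. -/
theorem HasWidthLE.map {k : ℕ} {w : List α} {g : List α → List α} (h : HasWidthLE k w)
    (nil : g [] = []) (append : ∀ u v, g (u ++ v) = g u ++ g v)
    (rep : ∀ u, RepetitionWithSlack 0 u → RepetitionWithSlack 0 (g u)) : HasWidthLE k (g w) := by
  induction k generalizing w with
  | zero => obtain rfl : w = [] := h; exact nil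
  | succ k ih =>
    rcases h with rfl | ⟨i, _, h1, h2⟩
    · rw [nil]; exact hasWidthLE_nil _
    · rw [← List.take_append_drop i w, append]
      exact HasWidthLE.cons (rep _ h1) (ih h2)

/-- If in a prefix-closed class of words `m + 1` repetitions can always be replaced by `m`, then
every factorization of a word of the class can be shortened to width `m`. -/
theorem hasWidthLE_flatten {C : List α → Prop} {m : ℕ}
    (hC : ∀ u v, C (u ++ v) → C u) (hm : ∀ w, C w → HasWidthLE (m + 1) w → HasWidthLE m w)
    (ws : List (List α)) (hr : ∀ u ∈ ws, IsRepetition u) (hw : C ws.flatten) :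
    HasWidthLE m ws.flatten := by
  induction ws using List.reverseRecOn with
  | nil => exact hasWidthLE_nil m
  | append_singleton ws u ih =>
    have he : (ws ++ [u]).flatten = ws.flatten ++ u := by simp
    rw [he] at hw ⊢
    exact hm _ hw ((ih (fun v hv => hr v (by simp [hv])) (hC _ _ hw)).append_singleton
      (hr u (by simp)))

theorem exists_isRepFactorization {C : List α → Prop} {m : ℕ}
    (hC : ∀ u v, C (u ++ v) → C u) (hm : ∀ w, C w → HasWidthLE (m + 1) w → HasWidthLE m w)
    {w : List α} (hw : C w) (h : HasRepFactorization w) :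
    ∃ ws, IsRepFactorization w ws ∧ width ws ≤ m := by
  obtain ⟨vs, hne, rfl, hr⟩ := h
  obtain ⟨ws, hl, hf, hr'⟩ := hasWidthLE_iff.1 (hasWidthLE_flatten hC hm vs hr hw)
  refine ⟨ws, ⟨?_, hf, hr'⟩, hl⟩
  rintro rfl
  obtain ⟨u, us, rfl⟩ := List.exists_cons_of_ne_nil hne
  have : u = [] := by
    simp only [List.flatten_nil, List.flatten_cons] at hf
    exact (List.append_eq_nil_iff.1 hf.symm).1
  exact (hr u (by simp)).1 this

end Words

/-! ### The morphism and repetitions -/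

@[simp]
theorem fibMorphism_nil : fibMorphism [] = [] := rfl

@[simp]
theorem fibMorphism_zero_cons (w : List (Fin 2)) :
    fibMorphism (0 :: w) = 0 :: 1 :: fibMorphism w := rfl

@[simp]
theorem fibMorphism_one_cons (w : List (Fin 2)) :
    fibMorphism (1 :: w) = 0 :: fibMorphism w := rfl

theorem length_le_length_fibMorphism (w : List (Fin 2)) :
    w.length ≤ (fibMorphism w).length := by
  induction w with
  | nil => simp
  | cons a w ih => fin_cases a <;> simp <;> omega

theorem exists_fibMorphism_eq_zero_cons {w : List (Fin 2)} (h : w ≠ []) :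
    ∃ t, fibMorphism w = 0 :: t := by
  obtain ⟨a, w, rfl⟩ := List.exists_cons_of_ne_nil h
  fin_cases a <;> simp

/-- The image of a word with a period may be prolonged by `0`, the first letter of every nonempty
image, so that one letter of slack is gained. -/
theorem RepetitionWithSlack.fibMorphism_append_zero {c : ℕ} {w : List (Fin 2)}
    (h : RepetitionWithSlack c w) : RepetitionWithSlack (c + 1) (fibMorphism w ++ [0]) := by
  obtain ⟨p, h1, h2, h3⟩ := h
  obtain ⟨s, hs⟩ := h3
  have hsne : s ≠ [] := by
    rintro rfl
    have := congrArg List.length hs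
    simp only [List.append_nil, List.length_append, List.length_take] at this
    omega
  obtain ⟨t, ht⟩ := exists_fibMorphism_eq_zero_cons hsne
  have hp := congrArg fibMorphism hs
  rw [fibMorphism_append, fibMorphism_append, ht] at hp
  -- `w` begins with the square of its prefix of length `p`
  obtain ⟨z, hz⟩ : w.take p <+: w.drop p :=
    List.prefix_of_prefix_length_le (List.take_prefix p w)
      (hasPeriod_iff_drop_prefix.1 ⟨s, hs⟩) (by simp; omega)
  have hw : w = w.take p ++ (w.take p ++ z) := by rw [hz, List.take_append_drop]
  have hzl : c ≤ z.length := by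
    have := congrArg List.length hw
    simp at this
    omega
  have hφ : fibMorphism w =
      fibMorphism (w.take p) ++ (fibMorphism (w.take p) ++ fibMorphism z) := by
    conv_lhs => rw [hw]
    simp only [fibMorphism_append]
  have hxl := length_le_length_fibMorphism (w.take p)
  have hzl' := length_le_length_fibMorphism z
  refine ⟨(fibMorphism (w.take p)).length, ?_, ?_, ?_⟩
  · simp only [List.length_take] at hxl
    omega
  · rw [hφ]
    simp only [List.length_append, List.length_singleton]
    omega
  · have htake : (fibMorphism w ++ [0]).take (fibMorphism (w.take p)).length =
        fibMorphism (w.take p) := by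
      rw [hφ, List.append_assoc, List.take_left']
      rfl
    rw [List.HasPeriod, htake]
    exact ⟨t ++ [0], by rw [← List.append_assoc (fibMorphism (w.take p)), ← hp]; simp⟩

theorem RepetitionWithSlack.fibMorphism {c : ℕ} {w : List (Fin 2)}
    (h : RepetitionWithSlack c w) : RepetitionWithSlack c (fibMorphism w) :=
  h.fibMorphism_append_zero.of_infix (List.prefix_append _ _).isInfix (by simp)

/-- The conjugate morphism `0 ↦ 10`, `1 ↦ 0`, written as `φ w ++ [0]` without its first letter. -/
def fibConj (w : List (Fin 2)) : List (Fin 2) := (fibMorphism w ++ [0]).tail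

theorem zero_cons_fibConj (w : List (Fin 2)) : 0 :: fibConj w = fibMorphism w ++ [0] := by
  obtain _ | ⟨a, w⟩ := w
  · rfl
  · fin_cases a <;> rfl

theorem fibConj_append (u v : List (Fin 2)) : fibConj (u ++ v) = fibConj u ++ fibConj v := by
  have h : 0 :: fibConj (u ++ v) = 0 :: (fibConj u ++ fibConj v) := by
    rw [← List.cons_append, zero_cons_fibConj, zero_cons_fibConj, List.append_assoc,
      List.singleton_append, zero_cons_fibConj, fibMorphism_append, List.append_assoc]
  exact (List.cons.inj h).2

theorem RepetitionWithSlack.fibConj {c : ℕ} {w : List (Fin 2)}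
    (h : RepetitionWithSlack c w) : RepetitionWithSlack c (fibConj w) :=
  h.fibMorphism_append_zero.of_infix (List.tail_suffix _).isInfix (by simp [FibRep.fibConj])

theorem HasWidthLE.fibMorphism {k : ℕ} {w : List (Fin 2)} (h : HasWidthLE k w) :
    HasWidthLE k (fibMorphism w) :=
  h.map rfl fibMorphism_append fun _ => RepetitionWithSlack.fibMorphism

theorem HasWidthLE.fibConj {k : ℕ} {w : List (Fin 2)} (h : HasWidthLE k w) :
    HasWidthLE k (fibConj w) :=
  h.map rfl fibConj_append fun _ => RepetitionWithSlack.fibConj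

/-- The last term of a factorization of `w`, prolonged by `0`, acquires slack. -/
theorem HasWidthLE.exists_slack_fibMorphism_append_zero {k : ℕ} {w : List (Fin 2)}
    (h : HasWidthLE (k + 1) w) (hw : w ≠ []) :
    ∃ u v, FibRep.fibMorphism w ++ [0] = u ++ v ∧ HasWidthLE k u ∧ RepetitionWithSlack 1 v := by
  obtain ⟨ws, hl, rfl, hr⟩ := hasWidthLE_iff.1 h
  induction ws using List.reverseRecOn with
  | nil => simp at hw
  | append_singleton ws x _ =>
    refine ⟨FibRep.fibMorphism ws.flatten, FibRep.fibMorphism x ++ [0], ?_, ?_, ?_⟩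
    · simp [fibMorphism_append]
    · exact (hasWidthLE_iff.2 ⟨ws, by simpa using hl, rfl,
        fun u hu => hr u (by simp [hu])⟩).fibMorphism
    · exact (repetitionWithSlack_zero_iff.2 (hr x (by simp))).fibMorphism_append_zero

theorem HasWidthLE.fibMorphism_append_zero {k : ℕ} {w : List (Fin 2)}
    (h : HasWidthLE (k + 1) w) (hw : w ≠ []) :
    HasWidthLE (k + 1) (FibRep.fibMorphism w ++ [0]) := by
  obtain ⟨u, v, he, hu, hv⟩ := h.exists_slack_fibMorphism_append_zero hw
  rw [he]
  exact hu.append_singleton (repetitionWithSlack_zero_iff.1 (hv.mono (Nat.zero_le 1)))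

/-! ### Desubstitution -/

/-- A cut of an image `φ u` lies between the images of two letters or inside some `φ 0 = 01`. -/
theorem fibMorphism_eq_append {u a c : List (Fin 2)} (h : fibMorphism u = a ++ c) :
    (∃ u₁ u₂, u = u₁ ++ u₂ ∧ a = fibMorphism u₁ ∧ c = fibMorphism u₂) ∨
      ∃ u₁ u₂, u = u₁ ++ 0 :: u₂ ∧ a = fibMorphism u₁ ++ [0] ∧ c = 1 :: fibMorphism u₂ := by
  induction u generalizing a with
  | nil =>
    obtain ⟨rfl, rfl⟩ := List.append_eq_nil_iff.1 h.symm
    exact Or.inl ⟨[], [], rfl, rfl, rfl⟩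
  | cons x u ih =>
    obtain _ | ⟨a₀, a⟩ := a
    · exact Or.inl ⟨[], x :: u, rfl, rfl, h.symm⟩
    obtain rfl | rfl : x = 0 ∨ x = 1 := by fin_cases x <;> simp
    · obtain _ | ⟨a₁, a⟩ := a
      · simp only [fibMorphism_zero_cons, List.cons_append, List.nil_append, List.cons.injEq] at h
        exact Or.inr ⟨[], u, rfl, by simp [← h.1], h.2.symm⟩
      · simp only [fibMorphism_zero_cons, List.cons_append, List.cons.injEq] at h
        obtain ⟨rfl, rfl, h⟩ := h
        rcases ih h with ⟨u₁, u₂, rfl, rfl, rfl⟩ | ⟨u₁, u₂, rfl, rfl, rfl⟩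
        · exact Or.inl ⟨0 :: u₁, u₂, rfl, rfl, rfl⟩
        · exact Or.inr ⟨0 :: u₁, u₂, rfl, rfl, rfl⟩
    · simp only [fibMorphism_one_cons, List.cons_append, List.cons.injEq] at h
      obtain ⟨rfl, h⟩ := h
      rcases ih h with ⟨u₁, u₂, rfl, rfl, rfl⟩ | ⟨u₁, u₂, rfl, rfl, rfl⟩
      · exact Or.inl ⟨1 :: u₁, u₂, rfl, rfl, rfl⟩
      · exact Or.inr ⟨1 :: u₁, u₂, rfl, rfl, rfl⟩

/-- The words of the next level that come from a prefix `v` of the Fibonacci word. If `v` ends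
with `1`, then `φ v` is left out, being `φ v' ++ [0]` for the word `v'` with `v = v' ++ [1]`. -/
def prefixDescendants (v : List (Fin 2)) : List (List (Fin 2)) :=
  (fibMorphism v ++ [0]) :: if v.getLast? = some 0 then [fibMorphism v] else []

/-- The words of the next level that come from a factor `v` of the Fibonacci word, sorted by their
first and last letters so that each word has only one ancestor. -/
def descendants (v : List (Fin 2)) : List (List (Fin 2)) :=
  prefixDescendants v ++
    if v.head? = some 0 then
      fibConj v :: if v.getLast? = some 0 then [(fibMorphism v).tail] else []
    else []

theorem eq_nil_or_getLast?_eq (v : List (Fin 2)) :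
    v = [] ∨ v.getLast? = some 0 ∨ ∃ v', v = v' ++ [1] := by
  induction v using List.reverseRecOn with
  | nil => simp
  | append_singleton v a _ =>
    obtain rfl | rfl : a = 0 ∨ a = 1 := by fin_cases a <;> simp
    · simp
    · exact Or.inr (Or.inr ⟨v, rfl⟩)

theorem prefix_desubstitution {u w : List (Fin 2)} (h : w <+: fibMorphism u) (hw : w ≠ []) :
    ∃ v, v <+: u ∧ w ∈ prefixDescendants v := by
  obtain ⟨b, hb⟩ := h
  rcases fibMorphism_eq_append hb.symm with ⟨v, t, rfl, rfl, -⟩ | ⟨v, t, rfl, rfl, -⟩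
  · rcases eq_nil_or_getLast?_eq v with rfl | hv | ⟨v, rfl⟩
    · exact absurd rfl hw
    · exact ⟨v, List.prefix_append _ _, by simp [prefixDescendants, hv]⟩
    · exact ⟨v, by simp, by simp [prefixDescendants, fibMorphism_append]⟩
  · exact ⟨v, List.prefix_append _ _, by simp [prefixDescendants]⟩

theorem desubstitution {u w : List (Fin 2)} (h : w <:+: fibMorphism u) (hw : w ≠ [])
    (hw₁ : w ≠ [1]) : ∃ v, v <:+: u ∧ w ∈ descendants v := by
  obtain ⟨a, b, hab⟩ := h
  rw [List.append_assoc] at hab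
  rcases fibMorphism_eq_append hab.symm with ⟨s, t, rfl, rfl, ht⟩ | ⟨s, t, rfl, rfl, ht⟩
  · obtain ⟨v, hv, hwv⟩ := prefix_desubstitution ⟨b, ht⟩ hw
    exact ⟨v, hv.isInfix.trans (List.suffix_append _ _).isInfix, List.mem_append_left _ hwv⟩
  · -- `w` begins inside an image `φ 0 = 01`, with the letter `1`
    obtain ⟨a₀, w, rfl⟩ := List.exists_cons_of_ne_nil hw
    simp only [List.cons_append, List.cons.injEq] at ht
    obtain ⟨rfl, ht⟩ := ht
    have hw' : w ≠ [] := by rintro rfl; exact hw₁ rfl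
    obtain ⟨v, hv, hwv⟩ := prefix_desubstitution ⟨b, ht⟩ hw'
    refine ⟨0 :: v, ?_, ?_⟩
    · exact ((List.prefix_append_right_inj [0]).2 hv).isInfix.trans
        (List.suffix_append s _).isInfix
    · simp only [prefixDescendants, List.mem_cons] at hwv
      rcases hwv with rfl | hwv
      · exact List.mem_append_right _ (by simp [fibConj])
      · split_ifs at hwv with hl
        · obtain rfl : w = fibMorphism v := by simpa using hwv
          have hl' : (0 :: v).getLast? = some 0 := by
            rw [List.getLast?_cons, hl]
            rfl
          refine List.mem_append_right _ ?_
          rw [if_pos (by simp), if_pos hl']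
          simp
        · simp at hwv

/-! ### Robust words and the exceptions -/

/-- `w` is nonempty, has width at most `3` and, if it begins and ends with `0`, this is witnessed
by a factorization whose first or last term is longer than twice its period. -/
def Robust (w : List (Fin 2)) : Prop :=
  w ≠ [] ∧ HasWidthLE 3 w ∧ (w.head? = some 0 ∧ w.getLast? = some 0 →
    ∃ i ∈ List.range (w.length + 1),
      (RepetitionWithSlack 1 (w.take i) ∧ HasWidthLE 2 (w.drop i)) ∨
      (HasWidthLE 2 (w.take i) ∧ RepetitionWithSlack 1 (w.drop i)))

instance : DecidablePred Robust := fun w => by unfold Robust; infer_instance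

theorem Robust.of_mem_descendants {v w : List (Fin 2)} (hv : Robust v) (hw : w ∈ descendants v) :
    Robust w := by
  obtain ⟨hne, h3, hs⟩ := hv
  simp only [descendants, prefixDescendants, List.mem_append, List.mem_cons] at hw
  rcases hw with (rfl | hw) | hw
  · refine ⟨by simp, h3.fibMorphism_append_zero hne, fun _ => ?_⟩
    obtain ⟨x, y, he, hx, hy⟩ := h3.exists_slack_fibMorphism_append_zero hne
    rw [he]
    exact ⟨x.length, by simp, Or.inr ⟨by simpa using hx, by simpa using hy⟩⟩
  · split_ifs at hw with hl
    · obtain rfl : w = fibMorphism v := by simpa using hw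
      obtain ⟨v, rfl⟩ := List.getLast?_eq_some_iff.1 hl
      refine ⟨by simp [fibMorphism_append], h3.fibMorphism, fun h => ?_⟩
      simp [fibMorphism_append] at h
    · simp at hw
  · split_ifs at hw with hh hl
    · have hf : (fibMorphism v).head? = some 0 ∧ (fibConj v).head? = some 1 ∧
          (fibMorphism v).tail.head? = some 1 ∧ fibMorphism v ≠ [] := by
        obtain ⟨v, rfl⟩ := List.head?_eq_some_iff.1 hh
        simp [fibConj]
      obtain ⟨-, hc, ht, hne'⟩ := hf
      rcases List.mem_cons.1 hw with rfl | hw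
      · refine ⟨by rintro h; simp [h] at hc, h3.fibConj, fun h => ?_⟩
        rw [hc] at h
        simp at h
      · obtain rfl : w = (fibMorphism v).tail := by simpa using hw
        refine ⟨by rintro h; simp [h] at ht, ?_, fun h => ?_⟩
        · obtain ⟨i, -, ⟨h1, h2⟩ | ⟨h1, h2⟩⟩ := hs ⟨hh, hl⟩
          · have hx : fibMorphism (v.take i) ≠ [] := by
              obtain ⟨p, hp, hp', -⟩ := h1.fibMorphism
              rintro h
              simp [h] at hp'
            rw [← List.take_append_drop i v, fibMorphism_append, List.tail_append_of_ne_nil hx]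
            exact HasWidthLE.cons (h1.fibMorphism.of_infix (c := 0) (d := 1)
              (List.tail_suffix _).isInfix (by rw [List.length_tail]; omega)) h2.fibMorphism
          · have hx : fibConj (v.drop i) ≠ [] := by
              obtain ⟨p, hp, hp', -⟩ := h2.fibConj
              rintro h
              simp [h] at hp'
            -- `φ v` without its first letter is `fibConj v` without its last letter
            have he : (fibMorphism v).tail =
                fibConj (v.take i) ++ (fibConj (v.drop i)).dropLast := by
              rw [← List.dropLast_append_of_ne_nil hx, ← fibConj_append,
                List.take_append_drop, fibConj, List.tail_append_of_ne_nil hne']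
              simp
            rw [he]
            exact h1.fibConj.append_singleton (repetitionWithSlack_zero_iff.1
              (h2.fibConj.of_infix (c := 0) (d := 1) (List.dropLast_prefix _).isInfix
                (by rw [List.length_dropLast]; omega)))
        · rw [ht] at h
          simp at h
    · obtain rfl : w = fibConj v := by simpa using hw
      have hc : (fibConj v).head? = some 1 := by
        obtain ⟨v, rfl⟩ := List.head?_eq_some_iff.1 hh
        simp [fibConj]
      refine ⟨by rintro h; simp [h] at hc, h3.fibConj, fun h => ?_⟩
      rw [hc] at h
      simp at h
    · simp at hw

/-- In the tree of descendants under `D`, every path from `w` reaches, within fewer than `n` steps,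
a word with `R`, and on the words before it `m + 1` repetitions can be replaced by `m`. -/
def Tame (R : List (Fin 2) → Prop) (D : List (Fin 2) → List (List (Fin 2))) (m : ℕ) :
    ℕ → List (Fin 2) → Prop
  | 0, _ => False
  | n + 1, w => R w ∨ ((HasWidthLE (m + 1) w → HasWidthLE m w) ∧ ∀ v ∈ D w, Tame R D m n v)

instance Tame.decidable (R : List (Fin 2) → Prop) [DecidablePred R]
    (D : List (Fin 2) → List (List (Fin 2))) (m : ℕ) :
    ∀ (n : ℕ) (w : List (Fin 2)), Decidable (Tame R D m n w)
  | 0, _ => inferInstanceAs (Decidable False)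
  | n + 1, w =>
    have (v : List (Fin 2)) : Decidable (Tame R D m n v) := Tame.decidable R D m n v
    inferInstanceAs (Decidable (R w ∨
      ((HasWidthLE (m + 1) w → HasWidthLE m w) ∧ ∀ v ∈ D w, Tame R D m n v)))

section Tame

variable {R : List (Fin 2) → Prop} {D : List (Fin 2) → List (List (Fin 2))} {m : ℕ}

theorem Tame.hasWidthLE (hR : ∀ w, R w → HasWidthLE m w) {n : ℕ} {w : List (Fin 2)}
    (h : Tame R D m n w) (hw : HasWidthLE (m + 1) w) : HasWidthLE m w := by
  obtain _ | n := n
  · exact h.elim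
  · rcases h with h | ⟨h, -⟩
    · exact hR w h
    · exact h hw

theorem exists_tame_of_mem (hD : ∀ v, R v → ∀ w ∈ D v, R w) {v w : List (Fin 2)}
    (h : ∃ n, Tame R D m n v) (hw : w ∈ D v) : ∃ n, Tame R D m n w := by
  obtain ⟨_ | n, h⟩ := h
  · exact h.elim
  · rcases h with h | ⟨-, h⟩
    · exact ⟨1, Or.inl (hD v h w hw)⟩
    · exact ⟨n, h w hw⟩

end Tame

theorem tame_nil : Tame Robust descendants 3 8 [] := by decide +kernel

theorem tame_one : Tame Robust descendants 3 8 [1] := by decide +kernel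

theorem tame_prefix_nil :
    Tame (fun w => w ≠ [] ∧ HasWidthLE 2 w) prefixDescendants 2 7 [] := by decide +kernel

theorem eq_nil_or_eq_zero_of_infix {w : List (Fin 2)} (h : w <:+: fibIterate 0) :
    w = [] ∨ w = [0] := by
  have hl := h.length_le
  obtain _ | ⟨a, _ | ⟨b, w⟩⟩ := w
  · exact Or.inl rfl
  · exact Or.inr (by simpa [fibIterate] using h.subset)
  · simp [fibIterate] at hl

theorem exists_tame_of_infix {m : ℕ} {w : List (Fin 2)} (h : w <:+: fibIterate m) :
    ∃ n, Tame Robust descendants 3 n w := by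
  have step {v w : List (Fin 2)} (hv : ∃ n, Tame Robust descendants 3 n v)
      (hw : w ∈ descendants v) : ∃ n, Tame Robust descendants 3 n w :=
    exists_tame_of_mem (fun _ hv _ hw => hv.of_mem_descendants hw) hv hw
  induction m generalizing w with
  | zero =>
    rcases eq_nil_or_eq_zero_of_infix h with rfl | rfl
    · exact ⟨8, tame_nil⟩
    · exact step ⟨8, tame_nil⟩ (by decide)
  | succ m ih =>
    by_cases h0 : w = []
    · exact ⟨8, h0 ▸ tame_nil⟩
    by_cases h1 : w = [1]
    · exact ⟨8, h1 ▸ tame_one⟩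
    rw [fibIterate_succ] at h
    obtain ⟨v, hv, hwv⟩ := desubstitution h h0 h1
    exact step (ih hv) hwv

theorem exists_tame_of_prefix {m : ℕ} {w : List (Fin 2)} (h : w <+: fibIterate m) :
    ∃ n, Tame (fun w => w ≠ [] ∧ HasWidthLE 2 w) prefixDescendants 2 n w := by
  have hD : ∀ v : List (Fin 2), v ≠ [] ∧ HasWidthLE 2 v → ∀ w ∈ prefixDescendants v,
      w ≠ [] ∧ HasWidthLE 2 w := by
    rintro v ⟨hv, h2⟩ w hw
    simp only [prefixDescendants, List.mem_cons] at hw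
    rcases hw with rfl | hw
    · exact ⟨by simp, h2.fibMorphism_append_zero hv⟩
    · split_ifs at hw
      · obtain rfl : w = fibMorphism v := by simpa using hw
        obtain ⟨t, ht⟩ := exists_fibMorphism_eq_zero_cons hv
        exact ⟨by simp [ht], h2.fibMorphism⟩
      · simp at hw
  induction m generalizing w with
  | zero =>
    rcases eq_nil_or_eq_zero_of_infix h.isInfix with rfl | rfl
    · exact ⟨7, tame_prefix_nil⟩
    · exact exists_tame_of_mem hD ⟨7, tame_prefix_nil⟩ (by decide)
  | succ m ih =>
    by_cases h0 : w = []
    · exact ⟨7, h0 ▸ tame_prefix_nil⟩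
    rw [fibIterate_succ] at h
    obtain ⟨v, hv, hwv⟩ := prefix_desubstitution h h0
    exact exists_tame_of_mem hD (ih hv) hwv

/-! ### Shortening factorizations -/

theorem IsPrefix.exists_prefix_fibIterate {w : List (Fin 2)} (h : IsPrefix w fibWord) :
    ∃ m, w <+: fibIterate m := by
  obtain ⟨n, rfl⟩ := h
  exact ⟨n, block_prefix_fibIterate n⟩

theorem IsFactor.exists_infix_fibIterate {w : List (Fin 2)} (h : IsFactor w fibWord) :
    ∃ m, w <:+: fibIterate m := by
  obtain ⟨i, n, rfl⟩ := h
  have he : block fibWord 0 (i + n) = block fibWord 0 i ++ block fibWord i n := by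
    simp [block, List.range_add, Function.comp_def]
  exact ⟨i + n, (he ▸ (List.suffix_append _ _).isInfix).trans
    (block_prefix_fibIterate (i + n)).isInfix⟩

theorem hasWidthLE_three_of_four {w : List (Fin 2)} (h : ∃ m, w <:+: fibIterate m)
    (h4 : HasWidthLE 4 w) : HasWidthLE 3 w := by
  obtain ⟨m, h⟩ := h
  obtain ⟨n, hn⟩ := exists_tame_of_infix h
  exact hn.hasWidthLE (fun _ h => h.2.1) h4

theorem hasWidthLE_two_of_three {w : List (Fin 2)} (h : ∃ m, w <+: fibIterate m)
    (h3 : HasWidthLE 3 w) : HasWidthLE 2 w := by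
  obtain ⟨m, h⟩ := h
  obtain ⟨n, hn⟩ := exists_tame_of_prefix h
  exact hn.hasWidthLE (fun _ h => h.2) h3

end FibRep

theorem theorem4 :
    (∀ w : List (Fin 2), FibRep.IsFactor w FibRep.fibWord → FibRep.HasRepFactorization w →
      ∃ ws : List (List (Fin 2)), FibRep.IsRepFactorization w ws ∧ FibRep.width ws ≤ 3) ∧
    (∀ w : List (Fin 2), FibRep.IsPrefix w FibRep.fibWord → FibRep.HasRepFactorization w →
      ∃ ws : List (List (Fin 2)), FibRep.IsRepFactorization w ws ∧ FibRep.width ws ≤ 2) := by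
  constructor
  · intro w hw
    refine FibRep.exists_isRepFactorization (C := fun w => ∃ m, w <:+: FibRep.fibIterate m)
      ?_ (fun _ => FibRep.hasWidthLE_three_of_four) hw.exists_infix_fibIterate
    rintro u v ⟨m, h⟩
    exact ⟨m, (List.prefix_append u v).isInfix.trans h⟩
  · intro w hw
    refine FibRep.exists_isRepFactorization (C := fun w => ∃ m, w <+: FibRep.fibIterate m)
      ?_ (fun _ => FibRep.hasWidthLE_two_of_three) hw.exists_prefix_fibIterate
    rintro u v ⟨m, h⟩
    exact ⟨m, (List.prefix_append u v).trans h⟩
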